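/- Conventions. Let $\mathcal{S},\mathcal{E},\mathcal{F}$ be (elementary) toposes. A geometric morphism $p:\mathcal{E}\to\mathcal{S}$ is \emph{pre-cohesive} if $p^*\dashv p_*$ extends to a string of adjoints $p_!\dashv p^*\dashv p_*\dashv p^!$ such that $p^*,p^!:\mathcal{S}\to\mathcal{E}$ are fully faithful, the canonical $\theta:p_*\to p_*p^*p_!\cong p_!$ is epi, and $p_!$ preserves finite products. For a finite-product-preserving functor $G$ between cartesian closed categories let $\kappa^G_{U,V}:G(V^U)\to (GV)^{GU}$ be the transpose of $G(V^U)\times GU\cong G(V^U\times U)\xrightarrow{G\,\mathrm{ev}}GV$. An object $X$ of $\mathcal{E}$ is \emph{weakly Kan} if $\kappa^{p_!}_{p^*A,X}:p_!(X^{p^*A})\to (p_!X)^{p_!p^*A}$ is an isomorphism for every $A$ in $\mathcal{S}$; $p$ is \emph{cohesive} if it is pre-cohesive and every object of $\mathcal{E}$ is weakly Kan. Let $\mathrm{wk}\,\mathcal{E}\subseteq\mathcal{E}$ be the full ($\mathcal{E}$-enriched) subcategory of weakly Kan objects. For an $\mathcal{E}$-enriched category $\mathcal{C}$ let $\mathbf{H}\mathcal{C}=(p_!)_\bullet\mathcal{C}$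 be the $\mathcal{S}$-enriched category with the objects of $\mathcal{C}$, hom objects $p_!(\mathcal{C}(X,Y))$, and composition and identities obtained by applying $p_!$. In particular the Hurewicz category $\mathbf{H}\mathcal{E}=(p_!)_\bullet\mathcal{E}$ has $(\mathbf{H}\mathcal{E})(X,Y)=p_!(Y^X)$. Let $g:\mathcal{F}\to\mathcal{E}$ and $p:\mathcal{E}\to\mathcal{S}$ be geometric morphisms and $f=pg:\mathcal{F}\to\mathcal{S}$ (so $f^*=g^*p^*$ and $f_*=p_*g_*$), with $p$ and $f$ pre-cohesive. Let $\nu,\xi$ be the unit and counit of $g^*\dashv g_*$. We say that $g$ \emph{preserves pieces} if $\nu_{p^*}:p^*\to g_*g^*p^*=g_*f^*$ is an isomorphism (so that its mate $\varrho:f_!g^*\to p_!$ is an isomorphism, with inverse $\rho$) and the composite $\lambda:p_!g_*\xrightarrow{\rho_{g_*}}f_!g^*g_*\xrightarrow{f_!\xi}f_!$ is an isomorphism. \textbf{Proposition.} Suppose that $g$ preserves pieces. Then $g$ induces an $\mathcal{S}$-enriched adjunction $\breve{g^*}\dashv\breve{g_*}:\mathbf{H}\mathcal{F}\to\mathbf{H}\mathcal{E}$,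 where $\mathbf{H}\mathcal{F}=(f_!)_\bullet\mathcal{F}$ and $\mathbf{H}\mathcal{E}=(p_!)_\bullet\mathcal{E}$. Explicitly, $\breve{g_*}$ is the $\mathcal{S}$-functor given on objects by $g_*$ and on homs by $$f_!(Y^X)\xrightarrow{\lambda^{-1}}p_!g_*(Y^X)\xrightarrow{p_!\kappa^{g_*}}p_!\big((g_*Y)^{g_*X}\big),$$ $\breve{g^*}$ is the $\mathcal{S}$-functor given on objects by $g^*$ and on homs by $$p_!(Y^X)\xrightarrow{p_!\nu}p_!g_*g^*(Y^X)\xrightarrow{p_!g_*\kappa^{g^*}}p_!g_*\big((g^*Y)^{g^*X}\big)\xrightarrow{\lambda}f_!\big((g^*Y)^{g^*X}\big),$$ and the unit and counit of the adjunction are $1\cong p_!1\xrightarrow{p_!\ulcorner\nu_X\urcorner}p_!\big((g_*g^*X)^X\big)$ and $1\cong f_!1\xrightarrow{f_!\ulcorner\xi_Y\urcorner}f_!\big(Y^{g^*g_*Y}\big)$, where $\ulcorner a\urcorner:1\to V^U$ denotes the name of $a:U\to V$. If, moreover, $f$ is cohesive, then $g_*Y$ is weakly Kan for every $Y$ in $\mathcal{F}$,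 and the above adjunction restricts to an $\mathcal{S}$-enriched adjunction $\breve{g^*}\dashv\breve{g_*}:\mathbf{H}\mathcal{F}\to\mathbf{H}(\mathrm{wk}\,\mathcal{E})$, with the same actions on objects and homs and the same unit and counit. -/

import Mathlib

open CategoryTheory Limits MonoidalCategory CartesianMonoidalCategory
open scoped CategoryTheory.MonoidalClosed

universe v₁ v₂ v₃ u₁ u₂ u₃ w w₁ w₂

noncomputable section

namespace Hurewicz

/-! ### Exponential comparison -/

section Comparison

variable {C : Type u₁} [Category.{v₁} C] [CartesianMonoidalCategory C] [MonoidalClosed C]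
variable {D : Type u₂} [Category.{v₂} D] [CartesianMonoidalCategory D] [MonoidalClosed D]

/-- For a functor `G` preserving finite products, the comparison `κ : G(V^U) ⟶ (G V)^(G U)`, the
exponential transpose of `G U ⨯ G(V^U) ≅ G(U ⨯ V^U) ⟶ G V`. -/
def kappa (G : C ⥤ D) [PreservesFiniteProducts G] (U V : C) :
    G.obj ((ihom U).obj V) ⟶ (ihom (G.obj U)).obj (G.obj V) :=
  MonoidalClosed.curry
    ((prodComparisonIso G U ((ihom U).obj V)).inv ≫ G.map ((ihom.ev U).app V))

/-- The name `⌜a⌝ : 1 ⟶ V^U` of a morphism `a : U ⟶ V`: the exponential transpose of `a`. -/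
def name {U V : C} (a : U ⟶ V) : 𝟙_ C ⟶ (ihom U).obj V :=
  MonoidalClosed.curry (fst U (𝟙_ C) ≫ a)

end Comparison

/-! ### Enriched functors, transformations and adjunctions -/

section Enriched

variable {V : Type w} [Category.{w₁} V] [MonoidalCategory V]
variable {C : Type u₁} [EnrichedCategory V C] {D : Type u₂} [EnrichedCategory V D]

/-- The data `(obj, map)` satisfy the two axioms of a `V`-enriched functor. -/
structure IsEnrichedFunctor (obj : C → D)
    (map : ∀ X Y : C, (X ⟶[V] Y) ⟶ (obj X ⟶[V] obj Y)) : Prop where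
  map_id : ∀ X : C, eId V X ≫ map X X = eId V (obj X)
  map_comp : ∀ X Y Z : C,
    eComp V X Y Z ≫ map X Z = (map X Y ⊗ₘ map Y Z) ≫ eComp V (obj X) (obj Y) (obj Z)

/-- The enriched functor with the given data. -/
@[simps]
def IsEnrichedFunctor.functor {obj : C → D}
    {map : ∀ X Y : C, (X ⟶[V] Y) ⟶ (obj X ⟶[V] obj Y)} (h : IsEnrichedFunctor obj map) :
    EnrichedFunctor V C D where
  obj := obj
  map := map
  map_id := h.map_id
  map_comp := h.map_comp

/-- A `V`-natural transformation between `V`-functors: a family `1 ⟶ D(F X, G X)` making the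
usual square over the hom objects `C(X, Y)` commute.  (Mathlib's `EnrichedNatTrans` only demands
naturality with respect to morphisms of the underlying ordinary categories, which is weaker.) -/
structure VNatTrans (F G : EnrichedFunctor V C D) where
  app : ∀ X : C, 𝟙_ V ⟶ (F.obj X ⟶[V] G.obj X)
  naturality : ∀ X Y : C,
    (ρ_ (X ⟶[V] Y)).inv ≫ (F.map X Y ⊗ₘ app Y) ≫ eComp V (F.obj X) (F.obj Y) (G.obj Y) =
      (λ_ (X ⟶[V] Y)).inv ≫ (app X ⊗ₘ G.map X Y) ≫ eComp V (F.obj X) (G.obj X) (G.obj Y)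

/-- A `V`-enriched adjunction `L ⊣ R`, that is, an adjunction in the 2-category of
`V`-categories: `V`-natural unit and counit satisfying the triangle identities. -/
structure EnrichedAdjunction (L : EnrichedFunctor V C D) (R : EnrichedFunctor V D C) where
  unit : VNatTrans (EnrichedFunctor.id V C) (L.comp V R)
  counit : VNatTrans (R.comp V L) (EnrichedFunctor.id V D)
  left_triangle : ∀ X : C,
    (λ_ (𝟙_ V)).inv ≫
      ((unit.app X ≫ L.map X (R.obj (L.obj X))) ⊗ₘ counit.app (L.obj X)) ≫
        eComp V (L.obj X) (L.obj (R.obj (L.obj X))) (L.obj X) = eId V (L.obj X)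
  right_triangle : ∀ Y : D,
    (λ_ (𝟙_ V)).inv ≫
      (unit.app (R.obj Y) ⊗ₘ (counit.app Y ≫ R.map (L.obj (R.obj Y)) Y)) ≫
        eComp V (R.obj Y) (R.obj (L.obj (R.obj Y))) (R.obj Y) = eId V (R.obj Y)

/-- The full `V`-subcategory determined by a property of objects. -/
instance fullSubcategoryEnriched {C : Type u₁} [Category.{v₁} C] [EnrichedCategory V C]
    (P : ObjectProperty C) : EnrichedCategory V P.FullSubcategory where
  Hom X Y := X.obj ⟶[V] Y.obj
  id X := eId V X.obj
  comp X Y Z := eComp V X.obj Y.obj Z.obj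
  id_comp X Y := e_id_comp V X.obj Y.obj
  comp_id X Y := e_comp_id V X.obj Y.obj
  assoc W X Y Z := e_assoc V W.obj X.obj Y.obj Z.obj

end Enriched

/-! ### Toposes and geometric morphisms -/

/-- A category with (chosen) finite products and exponentials is an (elementary) topos if it has
all finite limits and a subobject classifier. -/
class IsTopos (E : Type u₁) [Category.{v₁} E] [CartesianMonoidalCategory E]
    [MonoidalClosed E] : Prop where
  hasFiniteLimits : HasFiniteLimits E
  hasSubobjectClassifier : HasSubobjectClassifier E

/-- A geometric morphism `F ⟶ E`. -/
structure GeometricMorphism (F : Type u₁) [Category.{v₁} F] (E : Type u₂) [Category.{v₂} E] where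
  inverseImage : E ⥤ F
  directImage : F ⥤ E
  adj : inverseImage ⊣ directImage
  preservesFiniteLimits : PreservesFiniteLimits inverseImage

namespace GeometricMorphism

variable {F : Type u₁} [Category.{v₁} F] {E : Type u₂} [Category.{v₂} E]
  {S : Type u₃} [Category.{v₃} S]

instance (g : GeometricMorphism F E) : PreservesFiniteLimits g.inverseImage :=
  g.preservesFiniteLimits

instance (g : GeometricMorphism F E) : PreservesFiniteProducts g.inverseImage where
  preserves _ := inferInstance

instance (g : GeometricMorphism F E) : PreservesFiniteProducts g.directImage where
  preserves _ := ⟨fun {_} => g.adj.rightAdjoint_preservesLimits.preservesLimitsOfShape.1⟩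

/-- The composite `p g : F ⟶ S`, with `(p g)^* = g^* p^*` and `(p g)_* = p_* g_*`. -/
@[simps]
def comp (g : GeometricMorphism F E) (p : GeometricMorphism E S) : GeometricMorphism F S where
  inverseImage := p.inverseImage ⋙ g.inverseImage
  directImage := g.directImage ⋙ p.directImage
  adj := p.adj.comp g.adj
  preservesFiniteLimits := comp_preservesFiniteLimits _ _

/-- The canonical `θ : p_* ⟶ p_!`, that is `p_* ⟶ p_* p^* p_! ≅ p_!`, for `p_! ⊣ p^* ⊣ p_*` with
`p^*` fully faithful. -/
def theta (p : GeometricMorphism E S) {pieces : E ⥤ S} (adj : pieces ⊣ p.inverseImage)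
    [p.inverseImage.Full] [p.inverseImage.Faithful] (X : E) :
    p.directImage.obj X ⟶ pieces.obj X :=
  p.directImage.map (adj.unit.app X) ≫ inv (p.adj.unit.app (pieces.obj X))

/-- A pre-cohesive structure on `p`: the adjunction `p^* ⊣ p_*` extends to a string
`p_! ⊣ p^* ⊣ p_* ⊣ p^!` with `p^*`, `p^!` fully faithful, `θ : p_* ⟶ p_!` epi and `p_!` preserving
finite products. (The two extra adjoints are unique up to isomorphism.) -/
structure PreCohesive (p : GeometricMorphism E S) where
  /-- `p_!` -/
  pieces : E ⥤ S
  piecesAdj : pieces ⊣ p.inverseImage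
  /-- `p^!` -/
  codiscrete : S ⥤ E
  codiscreteAdj : p.directImage ⊣ codiscrete
  [full_inverseImage : p.inverseImage.Full]
  [faithful_inverseImage : p.inverseImage.Faithful]
  [full_codiscrete : codiscrete.Full]
  [faithful_codiscrete : codiscrete.Faithful]
  nullstellensatz : ∀ X : E, Epi (p.theta piecesAdj X)
  preservesFiniteProducts : PreservesFiniteProducts pieces

namespace PreCohesive

section Base

variable {p : GeometricMorphism E S} (hp : p.PreCohesive)

instance : PreservesFiniteProducts hp.pieces := hp.preservesFiniteProducts

variable [CartesianMonoidalCategory E] [MonoidalClosed E]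
  [CartesianMonoidalCategory S] [MonoidalClosed S]

instance : hp.pieces.Monoidal := Functor.Monoidal.ofChosenFiniteProducts hp.pieces

/-- `X` is weakly Kan if `κ : p_!(X^(p^* A)) ⟶ (p_! X)^(p_! (p^* A))` is an isomorphism for every
`A` in `S`. -/
def IsWeaklyKan : ObjectProperty E :=
  fun X => ∀ A : S, IsIso (kappa hp.pieces (p.inverseImage.obj A) X)

/-- A pre-cohesive `p` is cohesive if it satisfies Continuity: for every `X` in `E` and `A` in `S`,
`κ : p_!(X^(p^* A)) ⟶ (p_! X)^(p_! (p^* A))` is an isomorphism. -/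
def IsCohesive : Prop :=
  ∀ (X : E) (A : S), IsIso (kappa hp.pieces (p.inverseImage.obj A) X)

/-- `H C = (p_!)_• C` for an `E`-category `C`: the `S`-category with the same objects, with hom
objects `p_!(C(X, Y))`, and with composition and identities obtained by applying `p_!`. -/
abbrev H (C : Type w) [EnrichedCategory E C] : Type w := TransportEnrichment hp.pieces C

/-- The full subcategory `wk E` of weakly Kan objects. It is an `E`-category, as a full
`E`-subcategory of `E`. -/
abbrev Wk : Type _ := hp.IsWeaklyKan.FullSubcategory

/-- A morphism `a : U ⟶ V` of `E`, regarded as the morphism `1 ≅ p_! 1 ⟶ p_!(V^U)` of `H E`. -/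
def homotopyName {U V : E} (a : U ⟶ V) : 𝟙_ S ⟶ hp.pieces.obj ((ihom U).obj V) :=
  Functor.LaxMonoidal.ε hp.pieces ≫ hp.pieces.map (name a)

end Base

/-! ### Preservation of pieces -/

variable {p : GeometricMorphism E S} {g : GeometricMorphism F E}

variable (p g) in
/-- `ν_{p^*} : p^* ⟶ g_* g^* p^*`, where `ν` is the unit of `g^* ⊣ g_*`. -/
def nuDiscrete : p.inverseImage ⟶ (p.inverseImage ⋙ g.inverseImage) ⋙ g.directImage :=
  Functor.whiskerLeft p.inverseImage g.adj.unit

variable (hp : p.PreCohesive) (hf : (g.comp p).PreCohesive)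

/-- The canonical `ϱ : f_! g^* ⟶ p_!`, the mate of `ν_{p^*} : p^* ⟶ g_* f^*`, for `f = p g`. -/
def varrho : g.inverseImage ⋙ hf.pieces ⟶ hp.pieces :=
  (conjugateEquiv hp.piecesAdj (g.adj.comp hf.piecesAdj)).symm (nuDiscrete p g)

instance [h : IsIso (nuDiscrete p g)] : IsIso (varrho hp hf) :=
  @conjugateEquiv_symm_iso _ _ _ _ _ _ _ _ hp.piecesAdj (g.adj.comp hf.piecesAdj)
    (nuDiscrete p g) h

/-- The canonical `λ : p_! g_* ⟶ f_!`, the composite `p_! g_* ⟶ f_! g^* g_* ⟶ f_!` of `ρ = ϱ⁻¹` and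
the counit of `g^* ⊣ g_*`. -/
def lam [IsIso (nuDiscrete p g)] (X : F) :
    hp.pieces.obj (g.directImage.obj X) ⟶ hf.pieces.obj X :=
  (inv (varrho hp hf)).app (g.directImage.obj X) ≫ hf.pieces.map (g.adj.counit.app X)

/-- `g : F ⟶ E` preserves pieces (over `S`): `g_*` preserves `S`-indexed coproducts, i.e.
`ν_{p^*}` is an isomorphism, and the canonical `λ : p_! g_* ⟶ f_!` is an isomorphism. -/
class PreservesPieces : Prop where
  [preservesIndexedCoproducts : IsIso (nuDiscrete p g)]
  isIso_lam : ∀ X : F, IsIso (lam hp hf X)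

attribute [instance] PreservesPieces.preservesIndexedCoproducts PreservesPieces.isIso_lam

variable [CartesianMonoidalCategory F] [MonoidalClosed F]
  [CartesianMonoidalCategory E] [MonoidalClosed E]
  [CartesianMonoidalCategory S] [MonoidalClosed S] [PreservesPieces hp hf]

/-- The action of `g_*` on hom objects of the Hurewicz categories:
`f_!(Y^X) ≅ p_! g_*(Y^X) ⟶ p_!((g_* Y)^(g_* X))`. -/
def directImageMap (X Y : F) :
    hf.pieces.obj ((ihom X).obj Y) ⟶
      hp.pieces.obj ((ihom (g.directImage.obj X)).obj (g.directImage.obj Y)) :=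
  inv (lam hp hf ((ihom X).obj Y)) ≫ hp.pieces.map (kappa g.directImage X Y)

/-- The action of `g^*` on hom objects of the Hurewicz categories:
`p_!(Y^X) ⟶ p_! g_* g^*(Y^X) ⟶ p_! g_*((g^* Y)^(g^* X)) ≅ f_!((g^* Y)^(g^* X))`. -/
def inverseImageMap (X Y : E) :
    hp.pieces.obj ((ihom X).obj Y) ⟶
      hf.pieces.obj ((ihom (g.inverseImage.obj X)).obj (g.inverseImage.obj Y)) :=
  hp.pieces.map (g.adj.unit.app ((ihom X).obj Y) ≫
      g.directImage.map (kappa g.inverseImage X Y)) ≫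
    lam hp hf ((ihom (g.inverseImage.obj X)).obj (g.inverseImage.obj Y))

end PreCohesive

end GeometricMorphism

end Hurewicz

end

/-!
All the data of the enriched adjunction come from the ordinary adjunction `g^* ⊣ g_*` through the
exponential comparison `κ`, and the natural isomorphism `λ : p_! g_* ≅ f_!` only serves to move the
result from `p_! g_*` to `f_!`.

Over `E`, the comparison `κ` of `g_*` respects internal composition and names
(`μ_map_comp_kappa`, `ε_map_name_kappa`), and so does `ν ≫ g_* κ : Y^X ⟶ g_*((g^* Y)^(g^* X))`
(`comp_adjKappa`, `name_adjKappa`), because `ν` is a monoidal transformation. Naturality of the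
unit and of the counit with respect to internal homs amounts to two identities,
`adjKappa_kappa_pre_unit` and `kappa_adjKappa_map_counit`, both obtained by transposing and using
that `ν` and `ξ` are monoidal. Applying the product-preserving functor `p_!`, and transporting along
`λ`, which is automatically monoidal, gives the enriched functors and the enriched adjunction of
Hurewicz categories (`enrichedAdjunction`). The triangle identities reduce to the ordinary ones,
since the actions on homs send names to names and composition of names is the name of the
composite.

For the restriction to weakly Kan objects, the same two identities show that
`κ ≫ (g_* Y)^ν : g_*(Y^(g^* B)) ⟶ (g_* Y)^B` is invertible (`rightAdjointExpIso`). Through this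
isomorphism and `λ`, the comparison `κ` of `p_!` at `(B, g_* Y)` is the comparison of `f_!` at `(g^* B, Y)`,
reindexed along `p_! B ⟶ p_! g_* g^* B ≅ f_! g^* B` (`map_rightAdjointExpIso_hom_kappa`). The latter
map is the component at `B` of the isomorphism `ρ = ϱ⁻¹` (`map_unit_lam`); for `B = p^* A`,
Continuity of `f` therefore makes `g_* Y` weakly Kan.

The lemmas are stated for an adjunction `L ⊣ R` of product-preserving functors between cartesian
closed categories, product-preserving functors `P` and `Q` out of them, and `l : R ⋙ P ≅ Q`; the
application has `L = g^*`, `R = g_*`, `P = p_!`, `Q = f_!` and `l = λ`.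
-/

namespace Hurewicz

open Functor.LaxMonoidal MonoidalClosed

/-! ### The exponential comparison of a product-preserving functor -/

section Kappa

variable {C : Type u₁} [Category.{v₁} C] [CartesianMonoidalCategory C] [MonoidalClosed C]
variable {D : Type u₂} [Category.{v₂} D] [CartesianMonoidalCategory D] [MonoidalClosed D]

lemma name_eq_curry' {U V : C} (a : U ⟶ V) : name a = curry' a := by
  have : fst U (𝟙_ C) = (ρ_ U).hom := (rightUnitor_hom U).symm
  rw [name, curry', this]

lemma name_id (X : C) : name (𝟙 X) = MonoidalClosed.id X := by
  rw [name_eq_curry', curry'_id]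

lemma name_tensor_name_comp {X Y Z : C} (a : X ⟶ Y) (b : Y ⟶ Z) :
    (λ_ (𝟙_ C)).inv ≫ (name a ⊗ₘ name b) ≫ MonoidalClosed.comp X Y Z = name (a ≫ b) := by
  simp only [name_eq_curry', curry'_comp, MonoidalCategory.tensorHom_def, Category.assoc]

variable (G : C ⥤ D) [G.Monoidal]

/-- The comparison `κ` is the transpose of `G U ⊗ G(V^U) ⟶ G(U ⊗ V^U) ⟶ G V`, expressed through
the (unique) monoidal structure of `G`. -/
lemma uncurry_kappa (U V : C) :
    uncurry (kappa G U V) = μ G U ((ihom U).obj V) ≫ G.map ((ihom.ev U).app V) := by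
  rw [kappa, uncurry_curry, Functor.Monoidal.μ_of_cartesianMonoidalCategory]

lemma whiskerLeft_kappa_ev (U V : C) :
    G.obj U ◁ kappa G U V ≫ (ihom.ev (G.obj U)).app (G.obj V) =
      μ G U ((ihom U).obj V) ≫ G.map ((ihom.ev U).app V) := by
  rw [← uncurry_eq, uncurry_kappa]

lemma kappa_naturality_right (U : C) {V V' : C} (v : V ⟶ V') :
    G.map ((ihom U).map v) ≫ kappa G U V' = kappa G U V ≫ (ihom (G.obj U)).map (G.map v) := by
  apply uncurry_injective
  rw [uncurry_natural_left, uncurry_natural_right, uncurry_kappa, uncurry_kappa,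
    μ_natural_right_assoc, ← G.map_comp, ihom.ev_naturality]
  simp

lemma kappa_naturality_left {U U' : C} (u : U' ⟶ U) (V : C) :
    G.map ((pre u).app V) ≫ kappa G U' V =
      kappa G U V ≫ (pre (G.map u)).app (G.obj V) := by
  apply uncurry_injective
  rw [uncurry_natural_left, uncurry_kappa, uncurry_pre_app, uncurry_kappa, μ_natural_right_assoc,
    μ_natural_left_assoc, ← G.map_comp, ← G.map_comp, id_tensor_pre_app_comp_ev]

lemma ε_map_name_kappa {U V : C} (a : U ⟶ V) :
    ε G ≫ G.map (name a) ≫ kappa G U V = name (G.map a) := by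
  apply uncurry_injective
  rw [name_eq_curry', name_eq_curry', uncurry_natural_left, uncurry_natural_left, uncurry_kappa,
    μ_natural_right_assoc, ← G.map_comp, whiskerLeft_curry'_ihom_ev_app, curry', uncurry_curry]
  simp

/-- `κ` is compatible with internal composition, so that, together with `ε_map_name_kappa`, it
makes a product-preserving `G` into an enriched functor from `G_• C` to `D`. -/
lemma μ_map_comp_kappa (X Y Z : C) :
    μ G _ _ ≫ G.map (comp X Y Z) ≫ kappa G X Z =
      (kappa G X Y ⊗ₘ kappa G Y Z) ≫ comp (G.obj X) (G.obj Y) (G.obj Z) := by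
  apply uncurry_injective
  have h : X ◁ comp X Y Z ≫ (ihom.ev X).app Z = compTranspose X Y Z := by
    rw [← uncurry_eq, comp_eq, uncurry_curry]
  rw [uncurry_natural_left, uncurry_natural_left, uncurry_kappa, μ_natural_right_assoc,
    ← G.map_comp, h, uncurry_natural_left, comp_eq, uncurry_curry, compTranspose_eq,
    compTranspose_eq, MonoidalCategory.tensorHom_def, MonoidalCategory.whiskerLeft_comp,
    Category.assoc, associator_inv_naturality_right_assoc, whisker_exchange_assoc]
  dsimp only [Functor.id_obj]
  rw [whiskerLeft_kappa_ev,
    associator_inv_naturality_middle_assoc, ← comp_whiskerRight_assoc, whiskerLeft_kappa_ev]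
  simp

end Kappa

/-! ### Exponential comparisons along an adjunction -/

section Adjunction

variable {C : Type u₁} [Category.{v₁} C] [CartesianMonoidalCategory C]
variable {D : Type u₂} [Category.{v₂} D] [CartesianMonoidalCategory D]
variable {L : C ⥤ D} {R : D ⥤ C} [L.Monoidal] (adj : L ⊣ R)

section Monoidal

variable [R.Monoidal]

/-- The unit of `L ⊣ R` is a monoidal transformation, as is any natural transformation between
product-preserving functors. -/
lemma unit_tensor (X Y : C) :
    (adj.unit.app X ⊗ₘ adj.unit.app Y) ≫ μ R _ _ ≫ R.map (μ L X Y) = adj.unit.app (X ⊗ Y) := by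
  have := NatTrans.IsMonoidal.tensor (τ := adj.unit) X Y
  simpa using this.symm

lemma counit_tensor (X Y : D) :
    μ L _ _ ≫ L.map (μ R X Y) ≫ adj.counit.app (X ⊗ Y) = adj.counit.app X ⊗ₘ adj.counit.app Y := by
  have := NatTrans.IsMonoidal.tensor (τ := adj.counit) X Y
  simpa using this

lemma ε_map_ε : ε R ≫ R.map (ε L) = adj.unit.app (𝟙_ C) := by
  have := NatTrans.IsMonoidal.unit (τ := adj.unit)
  simpa using this.symm

end Monoidal

variable [MonoidalClosed C] [MonoidalClosed D]

/-- For an adjunction `L ⊣ R` with `L` product-preserving, the transpose across `L ⊣ R`,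
`Y^X ⟶ R((L Y)^(L X))`, of the comparison `κ : L(Y^X) ⟶ (L Y)^(L X)`. -/
noncomputable def adjKappa (X Y : C) :
    (ihom X).obj Y ⟶ R.obj ((ihom (L.obj X)).obj (L.obj Y)) :=
  adj.unit.app ((ihom X).obj Y) ≫ R.map (kappa L X Y)

lemma adjKappa_naturality_left {X X' : C} (u : X' ⟶ X) (Y : C) :
    (pre u).app Y ≫ adjKappa adj X' Y =
      adjKappa adj X Y ≫ R.map ((pre (L.map u)).app (L.obj Y)) := by
  rw [adjKappa, adjKappa, ← adj.unit_naturality_assoc, Category.assoc, ← R.map_comp, ← R.map_comp,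
    kappa_naturality_left]

variable [R.Monoidal]

lemma name_adjKappa {X Y : C} (a : X ⟶ Y) :
    name a ≫ adjKappa adj X Y = ε R ≫ R.map (name (L.map a)) := by
  rw [adjKappa, ← adj.unit_naturality_assoc, ← R.map_comp, ← ε_map_name_kappa, R.map_comp,
    ← ε_map_ε adj]
  simp

lemma comp_adjKappa (X Y Z : C) :
    comp X Y Z ≫ adjKappa adj X Z =
      (adjKappa adj X Y ⊗ₘ adjKappa adj Y Z) ≫ μ R _ _ ≫
        R.map (comp (L.obj X) (L.obj Y) (L.obj Z)) := by
  simp only [adjKappa]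
  rw [← adj.unit_naturality_assoc, ← unit_tensor, ← tensorHom_comp_tensorHom, Category.assoc,
    Category.assoc, Category.assoc, μ_natural_assoc]
  simp only [← R.map_comp, μ_map_comp_kappa]

/-- Naturality of the unit of `L ⊣ R` with respect to the internal homs of `C`. -/
lemma adjKappa_kappa_pre_unit (X Y : C) :
    adjKappa adj X Y ≫ kappa R (L.obj X) (L.obj Y) ≫
        (pre (B := X) (A := R.obj (L.obj X)) (adj.unit.app X)).app _ =
      (ihom X).map (adj.unit.app Y) := by
  apply uncurry_injective
  rw [uncurry_natural_left, uncurry_pre_app, uncurry_kappa, uncurry_ihom_map,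
    whisker_exchange_assoc, adjKappa, MonoidalCategory.whiskerLeft_comp, Category.assoc,
    μ_natural_right_assoc, ← R.map_comp, whiskerLeft_kappa_ev, R.map_comp,
    ← MonoidalCategory.tensorHom_def_assoc, reassoc_of% @unit_tensor]
  simp

/-- Naturality of the counit of `L ⊣ R` with respect to the internal homs of `D`. -/
lemma kappa_adjKappa_map_counit (X Y : D) :
    kappa R X Y ≫ adjKappa adj (R.obj X) (R.obj Y) ≫
        R.map ((ihom (L.obj (R.obj X))).map (adj.counit.app Y)) =
      R.map ((pre (B := L.obj (R.obj X)) (A := X) (adj.counit.app X)).app Y) := by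
  have key : L.map (kappa R X Y) ≫ kappa L (R.obj X) (R.obj Y) ≫
      (ihom (L.obj (R.obj X))).map (adj.counit.app Y) =
        adj.counit.app ((ihom X).obj Y) ≫
          (pre (B := L.obj (R.obj X)) (A := X) (adj.counit.app X)).app Y := by
    apply uncurry_injective
    rw [uncurry_natural_left, uncurry_natural_right, uncurry_kappa, uncurry_natural_left]
    dsimp only [Functor.id_obj]
    rw [uncurry_pre, Category.assoc, μ_natural_right_assoc, ← L.map_comp_assoc,
      whiskerLeft_kappa_ev, ← tensorHom_def'_assoc, ← counit_tensor]
    simp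
  rw [adjKappa, Category.assoc, ← adj.unit_naturality_assoc, ← R.map_comp, ← R.map_comp, key]
  simp

/-- For an adjunction `L ⊣ R` of product-preserving functors, `R(Y^(L B)) ⟶ (R Y)^B` is
invertible; the inverse is the transpose of `L((R Y)^B) ⟶ (L R Y)^(L B) ⟶ Y^(L B)`. -/
@[simps]
noncomputable def rightAdjointExpIso (B : C) (Y : D) :
    R.obj ((ihom (L.obj B)).obj Y) ≅ (ihom B).obj (R.obj Y) where
  hom := kappa R (L.obj B) Y ≫ (pre (B := B) (A := R.obj (L.obj B)) (adj.unit.app B)).app (R.obj Y)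
  inv := adjKappa adj B (R.obj Y) ≫ R.map ((ihom (L.obj B)).map (adj.counit.app Y))
  hom_inv_id := by
    rw [Category.assoc, reassoc_of% @adjKappa_naturality_left, ← R.map_comp, pre_comm_ihom_map,
      R.map_comp, reassoc_of% @kappa_adjKappa_map_counit, ← R.map_comp, ← NatTrans.comp_app,
      ← pre_map]
    simp
  inv_hom_id := by
    rw [Category.assoc, reassoc_of% @kappa_naturality_right, ← pre_comm_ihom_map,
      reassoc_of% @adjKappa_kappa_pre_unit, ← Functor.map_comp]
    simp

end Adjunction

/-! ### The enriched adjunction -/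

section Transport

variable {S : Type u₁} [Category.{v₁} S] [CartesianMonoidalCategory S]
variable {C : Type u₂} [Category.{v₂} C] [CartesianMonoidalCategory C]
variable {D : Type u₃} [Category.{v₃} D] [CartesianMonoidalCategory D]

section Composition

variable [MonoidalClosed C] (P : C ⥤ S) [P.Monoidal]

/-- In the transport of `C` along `P`, composing with the name of `b` is post-composition with `b`
on internal homs. -/
lemma comp_name {A : S} {X Y Z : C} (m : A ⟶ P.obj ((ihom X).obj Y)) (b : Y ⟶ Z) :
    (ρ_ A).inv ≫ (m ⊗ₘ (ε P ≫ P.map (name b))) ≫ μ P _ _ ≫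
      P.map (MonoidalClosed.comp X Y Z) = m ≫ P.map ((ihom X).map b) := by
  rw [MonoidalCategory.tensorHom_def, MonoidalCategory.whiskerLeft_comp]
  simp only [Category.assoc]
  rw [μ_natural_right_assoc, ← P.map_comp, name_eq_curry', whiskerLeft_curry'_comp, P.map_comp,
    ← rightUnitor_inv_naturality_assoc, Functor.LaxMonoidal.right_unitality_inv_assoc,
    ← P.map_comp_assoc]
  simp

/-- In the transport of `C` along `P`, composing with the name of `a` is pre-composition with `a`
on internal homs. -/
lemma name_comp {A : S} {X Y Z : C} (a : X ⟶ Y) (m : A ⟶ P.obj ((ihom Y).obj Z)) :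
    (λ_ A).inv ≫ ((ε P ≫ P.map (name a)) ⊗ₘ m) ≫ μ P _ _ ≫
      P.map (MonoidalClosed.comp X Y Z) = m ≫ P.map ((pre a).app Z) := by
  rw [MonoidalCategory.tensorHom_def', comp_whiskerRight]
  simp only [Category.assoc]
  rw [μ_natural_left_assoc, ← P.map_comp, name_eq_curry', curry'_whiskerRight_comp, P.map_comp,
    ← leftUnitor_inv_naturality_assoc, Functor.LaxMonoidal.left_unitality_inv_assoc,
    ← P.map_comp_assoc]
  simp

lemma name_comp_name {X Y Z : C} (a : X ⟶ Y) (b : Y ⟶ Z) :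
    (λ_ (𝟙_ S)).inv ≫ ((ε P ≫ P.map (name a)) ⊗ₘ (ε P ≫ P.map (name b))) ≫ μ P _ _ ≫
      P.map (MonoidalClosed.comp X Y Z) = ε P ≫ P.map (name (a ≫ b)) := by
  rw [name_comp, Category.assoc, ← P.map_comp, ← name_tensor_name_comp,
    MonoidalCategory.tensorHom_def', Category.assoc, name_eq_curry' a, curry'_whiskerRight_comp,
    ← leftUnitor_inv_naturality_assoc, Iso.inv_hom_id_assoc]

end Composition

variable {P : C ⥤ S} {Q : D ⥤ S} [P.Monoidal] [Q.Monoidal]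
variable {L : C ⥤ D} {R : D ⥤ C} [L.Monoidal] [R.Monoidal]
variable (adj : L ⊣ R) (l : R ⋙ P ≅ Q)

lemma ε_inv_app : ε Q ≫ l.inv.app (𝟙_ D) = ε P ≫ P.map (ε R) := by
  simp

lemma μ_inv_app (X Y : D) :
    μ Q X Y ≫ l.inv.app (X ⊗ Y) =
      (l.inv.app X ⊗ₘ l.inv.app Y) ≫ μ P _ _ ≫ P.map (μ R X Y) := by
  simp

lemma μ_hom_app (X Y : D) :
    μ P _ _ ≫ P.map (μ R X Y) ≫ l.hom.app (X ⊗ Y) = (l.hom.app X ⊗ₘ l.hom.app Y) ≫ μ Q X Y := by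
  have := NatTrans.IsMonoidal.tensor (τ := l.hom) X Y
  simpa using this

lemma ε_hom_app : ε P ≫ P.map (ε R) ≫ l.hom.app (𝟙_ D) = ε Q := by
  have := NatTrans.IsMonoidal.unit (τ := l.hom)
  simpa using this

variable [MonoidalClosed C] [MonoidalClosed D]

/-- The action of `R` on hom objects: `Q(Y^X) ≅ P R(Y^X) ⟶ P((R Y)^(R X))`. -/
noncomputable def rightMap (X Y : D) :
    Q.obj ((ihom X).obj Y) ⟶ P.obj ((ihom (R.obj X)).obj (R.obj Y)) :=
  l.inv.app ((ihom X).obj Y) ≫ P.map (kappa R X Y)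

/-- The action of `L` on hom objects: `P(Y^X) ⟶ P R((L Y)^(L X)) ≅ Q((L Y)^(L X))`. -/
noncomputable def leftMap (X Y : C) :
    P.obj ((ihom X).obj Y) ⟶ Q.obj ((ihom (L.obj X)).obj (L.obj Y)) :=
  P.map (adjKappa adj X Y) ≫ l.hom.app ((ihom (L.obj X)).obj (L.obj Y))

lemma name_rightMap {X Y : D} (a : X ⟶ Y) :
    (ε Q ≫ Q.map (name a)) ≫ rightMap l X Y = ε P ≫ P.map (name (R.map a)) := by
  have := l.inv.naturality (name a)
  dsimp only [Functor.comp_map] at this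
  rw [rightMap, Category.assoc, reassoc_of% this, reassoc_of% (ε_inv_app l), ← P.map_comp,
    ← P.map_comp, ε_map_name_kappa]

lemma name_leftMap {X Y : C} (a : X ⟶ Y) :
    (ε P ≫ P.map (name a)) ≫ leftMap adj l X Y = ε Q ≫ Q.map (name (L.map a)) := by
  have := l.hom.naturality (name (L.map a))
  dsimp only [Functor.comp_map] at this
  rw [leftMap, Category.assoc, ← P.map_comp_assoc, name_adjKappa, P.map_comp, Category.assoc,
    this, reassoc_of% (ε_hom_app l)]

lemma isEnrichedFunctor_rightMap :
    IsEnrichedFunctor (V := S) (C := TransportEnrichment Q D) (D := TransportEnrichment P C)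
      R.obj (fun X Y : D => rightMap l X Y) where
  map_id := fun (X : D) => by
    change (ε Q ≫ Q.map (MonoidalClosed.id (C := D) X)) ≫ rightMap l X X =
      ε P ≫ P.map (MonoidalClosed.id (R.obj X))
    rw [← name_id, ← name_id, name_rightMap, R.map_id]
  map_comp := fun (X Y Z : D) => by
    change (μ Q _ _ ≫ Q.map (MonoidalClosed.comp (C := D) X Y Z)) ≫ rightMap l X Z =
      (rightMap l X Y ⊗ₘ rightMap l Y Z) ≫ μ P _ _ ≫
        P.map (MonoidalClosed.comp (R.obj X) (R.obj Y) (R.obj Z))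
    have := l.inv.naturality (MonoidalClosed.comp (C := D) X Y Z)
    dsimp only [Functor.comp_map] at this
    simp only [rightMap]
    rw [Category.assoc, reassoc_of% this, reassoc_of% (μ_inv_app l),
      ← tensorHom_comp_tensorHom, Category.assoc, μ_natural_assoc, ← P.map_comp, ← P.map_comp,
      ← P.map_comp, μ_map_comp_kappa]

lemma isEnrichedFunctor_leftMap :
    IsEnrichedFunctor (V := S) (C := TransportEnrichment P C) (D := TransportEnrichment Q D)
      L.obj (fun X Y : C => leftMap adj l X Y) where
  map_id := fun (X : C) => by
    change (ε P ≫ P.map (MonoidalClosed.id (C := C) X)) ≫ leftMap adj l X X =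
      ε Q ≫ Q.map (MonoidalClosed.id (L.obj X))
    rw [← name_id, ← name_id, name_leftMap, L.map_id]
  map_comp := fun (X Y Z : C) => by
    change (μ P _ _ ≫ P.map (MonoidalClosed.comp (C := C) X Y Z)) ≫ leftMap adj l X Z =
      (leftMap adj l X Y ⊗ₘ leftMap adj l Y Z) ≫ μ Q _ _ ≫
        Q.map (MonoidalClosed.comp (L.obj X) (L.obj Y) (L.obj Z))
    have := l.hom.naturality (MonoidalClosed.comp (L.obj X) (L.obj Y) (L.obj Z))
    dsimp only [Functor.comp_map] at this
    simp only [leftMap]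
    rw [Category.assoc, ← P.map_comp_assoc, comp_adjKappa, P.map_comp, P.map_comp, Category.assoc,
      Category.assoc, this, ← μ_natural_assoc, reassoc_of% (μ_hom_app l),
      tensorHom_comp_tensorHom_assoc]

/-- `L ⊣ R` as an enriched adjunction between the transported self-enrichments; its unit and
counit are named by the ordinary ones. -/
noncomputable def enrichedAdjunction :
    EnrichedAdjunction (V := S) (C := TransportEnrichment P C) (D := TransportEnrichment Q D)
      (isEnrichedFunctor_leftMap adj l).functor
      (isEnrichedFunctor_rightMap (P := P) (R := R) l).functor where
  unit :=
    { app := fun X : C => ε P ≫ P.map (name (adj.unit.app X))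
      naturality := fun X Y : C => by
        refine (comp_name P (X := X) (𝟙 _) (adj.unit.app Y)).trans
          (.trans ?_ (name_comp P (adj.unit.app X) _).symm)
        change 𝟙 _ ≫ P.map ((ihom X).map (adj.unit.app Y)) =
          (leftMap adj l X Y ≫ rightMap l (L.obj X) (L.obj Y)) ≫
            P.map ((pre (B := X) (A := R.obj (L.obj X)) (adj.unit.app X)).app (R.obj (L.obj Y)))
        rw [leftMap, rightMap, Category.id_comp, Category.assoc, Category.assoc,
          Category.assoc, Iso.hom_inv_id_app_assoc, ← adjKappa_kappa_pre_unit, P.map_comp,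
          P.map_comp] }
  counit :=
    { app := fun Y : D => ε Q ≫ Q.map (name (adj.counit.app Y))
      naturality := fun X Y : D => by
        refine (comp_name Q (rightMap l X Y ≫ leftMap adj l _ _)
          (adj.counit.app Y)).trans
          (.trans ?_ (name_comp Q (adj.counit.app X) (𝟙 _)).symm)
        change (rightMap l X Y ≫ leftMap adj l (R.obj X) (R.obj Y)) ≫
            Q.map ((ihom (L.obj (R.obj X))).map (adj.counit.app Y)) =
          𝟙 _ ≫ Q.map ((pre (B := L.obj (R.obj X)) (A := X) (adj.counit.app X)).app Y)
        have h₁ := l.hom.naturality ((ihom (L.obj (R.obj X))).map (adj.counit.app Y))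
        have h₂ := l.hom.naturality
          ((pre (B := L.obj (R.obj X)) (A := X) (adj.counit.app X)).app Y)
        dsimp only [Functor.comp_map, Functor.comp_obj, Functor.id_obj] at h₁ h₂
        rw [leftMap, rightMap, Category.assoc, Category.assoc, Category.assoc, ← h₁,
          ← P.map_comp_assoc, ← P.map_comp_assoc, Category.assoc, kappa_adjKappa_map_counit, h₂,
          Iso.inv_hom_id_app_assoc, Category.id_comp] }
  left_triangle := fun (X : C) => by
    change (λ_ (𝟙_ S)).inv ≫ (((ε P ≫ P.map (name (adj.unit.app X))) ≫
      leftMap adj l _ _) ⊗ₘ _) ≫ μ Q _ _ ≫ Q.map (MonoidalClosed.comp _ _ _) =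
        ε Q ≫ Q.map (MonoidalClosed.id (L.obj X))
    rw [name_leftMap]
    refine (name_comp_name Q _ _).trans ?_
    rw [← name_id]
    exact congrArg (fun k => ε Q ≫ Q.map (name k)) (adj.left_triangle_components X)
  right_triangle := fun (Y : D) => by
    change (λ_ (𝟙_ S)).inv ≫ (_ ⊗ₘ ((ε Q ≫ Q.map (name (adj.counit.app Y))) ≫
      rightMap l _ _)) ≫ μ P _ _ ≫ P.map (MonoidalClosed.comp _ _ _) =
        ε P ≫ P.map (MonoidalClosed.id (R.obj Y))
    rw [name_rightMap]
    refine (name_comp_name P _ _).trans ?_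
    rw [← name_id]
    exact congrArg (fun k => ε P ≫ P.map (name k)) (adj.right_triangle_components Y)

end Transport

/-! ### Transfer of Continuity along the direct image -/

instance isIso_pre_app {V : Type u₁} [Category.{v₁} V] [MonoidalCategory V] [MonoidalClosed V]
    {A B : V} (f : B ⟶ A) [IsIso f] (X : V) : IsIso ((pre f).app X) :=
  inferInstanceAs (IsIso ((internalHom.map f.op).app X))

section WeaklyKan

variable {S : Type u₁} [Category.{v₁} S] [CartesianMonoidalCategory S] [MonoidalClosed S]
variable {C : Type u₂} [Category.{v₂} C] [CartesianMonoidalCategory C] [MonoidalClosed C]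
variable {D : Type u₃} [Category.{v₃} D] [CartesianMonoidalCategory D] [MonoidalClosed D]
variable {P : C ⥤ S} {Q : D ⥤ S} [P.Monoidal] [Q.Monoidal]
variable {L : C ⥤ D} {R : D ⥤ C} [L.Monoidal] [R.Monoidal]
variable (adj : L ⊣ R) (l : R ⋙ P ≅ Q)

/-- Under `P R ≅ Q` and `R(Y^(L B)) ≅ (R Y)^B`, the comparison `κ` of `P` at `R Y` is that of `Q`
at `Y`, up to reindexing along `P B ⟶ P R L B ≅ Q L B`. -/
lemma map_rightAdjointExpIso_hom_kappa (B : C) (Y : D) :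
    P.map (rightAdjointExpIso adj B Y).hom ≫ kappa P B (R.obj Y) ≫
        (ihom (P.obj B)).map (l.hom.app Y) =
      l.hom.app ((ihom (L.obj B)).obj Y) ≫ kappa Q (L.obj B) Y ≫
        (pre (P.map (adj.unit.app B) ≫ l.hom.app (L.obj B))).app (Q.obj Y) := by
  have h := l.hom.naturality ((ihom.ev (L.obj B)).app Y)
  dsimp only [Functor.comp_map, Functor.comp_obj, Functor.id_obj, curriedTensor_obj_obj] at h
  have e : B ◁ (rightAdjointExpIso adj B Y).hom ≫ (ihom.ev B).app (R.obj Y) =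
      adj.unit.app B ▷ _ ≫ μ R _ _ ≫ R.map ((ihom.ev (L.obj B)).app Y) := by
    rw [← uncurry_eq, rightAdjointExpIso_hom, uncurry_pre_app, uncurry_kappa]
  apply uncurry_injective
  rw [uncurry_natural_left, uncurry_natural_right, uncurry_kappa, uncurry_natural_left,
    uncurry_pre_app, uncurry_kappa, Category.assoc, μ_natural_right_assoc, ← P.map_comp_assoc, e]
  simp only [P.map_comp, Category.assoc]
  rw [h, ← μ_natural_left_assoc]
  dsimp only [Functor.comp_obj]
  rw [reassoc_of% (μ_hom_app l), comp_whiskerRight, Category.assoc,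
    MonoidalCategory.tensorHom_def_assoc, whisker_exchange_assoc,
    whisker_exchange_assoc]

/-- Since `R(Y^(L B)) ≅ (R Y)^B`, invertibility of `κ` passes from `Q` at `Y` to `P` at `R Y`, for
exponents `B` on which `P B ⟶ P R L B ≅ Q L B` is invertible. -/
lemma isIso_kappa_of_iso (B : C) (Y : D)
    [IsIso (P.map (adj.unit.app B) ≫ l.hom.app (L.obj B))] [IsIso (kappa Q (L.obj B) Y)] :
    IsIso (kappa P B (R.obj Y)) := by
  have h := map_rightAdjointExpIso_hom_kappa adj l B Y
  have h₁ : IsIso (P.map (rightAdjointExpIso adj B Y).hom ≫ kappa P B (R.obj Y) ≫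
      (ihom (P.obj B)).map (l.hom.app Y)) := by
    rw [h]; infer_instance
  have h₂ := IsIso.of_isIso_comp_left
    (P.map (rightAdjointExpIso adj B Y).hom)
    (kappa P B (R.obj Y) ≫ (ihom (P.obj B)).map (l.hom.app Y))
  exact IsIso.of_isIso_comp_right _ ((ihom (P.obj B)).map (l.hom.app Y))

end WeaklyKan

/-! ### Geometric morphisms that preserve pieces -/

namespace GeometricMorphism.PreCohesive

variable {F : Type u₁} [Category.{v₁} F] {E : Type u₂} [Category.{v₂} E]
  {S : Type u₃} [Category.{v₃} S] {p : GeometricMorphism E S} {g : GeometricMorphism F E}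
  (hp : p.PreCohesive) (hf : (g.comp p).PreCohesive)

/-- The inverse `ρ : p_! ⟶ f_! g^*` of the mate `ϱ` of `ν_{p^*}` is recovered from `λ` and the unit
of `g^* ⊣ g_*`. -/
lemma map_unit_lam [IsIso (nuDiscrete p g)] (B : E) :
    hp.pieces.map (g.adj.unit.app B) ≫ lam hp hf (g.inverseImage.obj B) =
      (inv (varrho hp hf)).app B := by
  have h := (inv (varrho hp hf)).naturality (g.adj.unit.app B)
  dsimp only [Functor.comp_map, Functor.comp_obj, Functor.id_obj] at h
  rw [lam, reassoc_of% h, ← hf.pieces.map_comp, g.adj.left_triangle_components,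
    CategoryTheory.Functor.map_id]
  exact Category.comp_id _

/-- `λ : p_! g_* ⟶ f_!` as a natural isomorphism, for `g` preserving pieces. -/
@[simps!]
noncomputable def lamIso [PreservesPieces hp hf] : g.directImage ⋙ hp.pieces ≅ hf.pieces :=
  NatIso.ofComponents (fun X => asIso (lam hp hf X)) fun {X Y} a => by
    have h₁ := (inv (varrho hp hf)).naturality (g.directImage.map a)
    have h₂ := g.adj.counit.naturality a
    dsimp only [Functor.comp_map, Functor.id_map, asIso_hom] at h₁ h₂ ⊢
    rw [lam, lam, reassoc_of% h₁, ← hf.pieces.map_comp, h₂, hf.pieces.map_comp, Category.assoc]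

end GeometricMorphism.PreCohesive

end Hurewicz

open Hurewicz GeometricMorphism PreCohesive in
theorem mainTheorem2
    {S : Type u₁} [Category.{v₁} S] [CartesianMonoidalCategory S] [MonoidalClosed S] [IsTopos S]
    {E : Type u₂} [Category.{v₂} E] [CartesianMonoidalCategory E] [MonoidalClosed E] [IsTopos E]
    {F : Type u₃} [Category.{v₃} F] [CartesianMonoidalCategory F] [MonoidalClosed F] [IsTopos F]
    (p : GeometricMorphism E S) (g : GeometricMorphism F E)
    (hp : p.PreCohesive) (hf : (g.comp p).PreCohesive) [PreservesPieces hp hf] :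
    ∃ (hL : IsEnrichedFunctor (V := S) (C := hp.H E) (D := hf.H F)
          g.inverseImage.obj (inverseImageMap hp hf))
      (hR : IsEnrichedFunctor (V := S) (C := hf.H F) (D := hp.H E)
          g.directImage.obj (directImageMap hp hf))
      (adj : EnrichedAdjunction hL.functor hR.functor),
      (∀ X : E, adj.unit.app X = hp.homotopyName (g.adj.unit.app X)) ∧
      (∀ Y : F, adj.counit.app Y = hf.homotopyName (g.adj.counit.app Y)) ∧
      (hf.IsCohesive →
        ∃ (hwk : ∀ Y : F, hp.IsWeaklyKan (g.directImage.obj Y))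
          (hL' : IsEnrichedFunctor (V := S) (C := hp.H hp.Wk) (D := hf.H F)
            (fun X : hp.Wk => g.inverseImage.obj X.obj)
            (fun X Y : hp.Wk => inverseImageMap hp hf X.obj Y.obj))
          (hR' : IsEnrichedFunctor (V := S) (C := hf.H F) (D := hp.H hp.Wk)
            (fun Y : F => (⟨g.directImage.obj Y, hwk Y⟩ : hp.Wk))
            (directImageMap hp hf))
          (adj' : EnrichedAdjunction hL'.functor hR'.functor),
          (∀ X : hp.Wk, adj'.unit.app X = adj.unit.app X.obj) ∧
          (∀ Y : F, adj'.counit.app Y = adj.counit.app Y)) := by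
  -- The choice is immaterial: monoidal structures on functors between cartesian monoidal categories
  -- are unique.
  let : g.inverseImage.Monoidal := .ofChosenFiniteProducts _
  let : g.directImage.Monoidal := .ofChosenFiniteProducts _
  refine ⟨isEnrichedFunctor_leftMap g.adj (lamIso hp hf),
    isEnrichedFunctor_rightMap (lamIso hp hf),
    enrichedAdjunction g.adj (lamIso hp hf), fun _ => rfl, fun _ => rfl, fun hc => ?_⟩
  have hwk (Y : F) : hp.IsWeaklyKan (g.directImage.obj Y) := fun A => by
    have h : IsIso (hp.pieces.map (g.adj.unit.app (p.inverseImage.obj A)) ≫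
        (lamIso hp hf).hom.app (g.inverseImage.obj (p.inverseImage.obj A))) := by
      rw [lamIso_hom_app, map_unit_lam]
      infer_instance
    have : IsIso (kappa hf.pieces (g.inverseImage.obj (p.inverseImage.obj A)) Y) := hc Y A
    exact isIso_kappa_of_iso g.adj (lamIso hp hf) (p.inverseImage.obj A) Y
  -- A full enriched subcategory has the hom objects and composition of the ambient category, so
  -- every axiom restricts verbatim.
  let hL := isEnrichedFunctor_leftMap g.adj (lamIso hp hf)
  let hR := isEnrichedFunctor_rightMap (lamIso hp hf)
  let adj := enrichedAdjunction g.adj (lamIso hp hf)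
  exact ⟨hwk,
    { map_id := fun X => hL.map_id X.obj
      map_comp := fun X Y Z => hL.map_comp X.obj Y.obj Z.obj },
    { map_id := hR.map_id
      map_comp := hR.map_comp },
    { unit :=
        { app := fun X => adj.unit.app X.obj
          naturality := fun X Y => adj.unit.naturality X.obj Y.obj }
      counit :=
        { app := adj.counit.app
          naturality := adj.counit.naturality }
      left_triangle := fun X => adj.left_triangle X.obj
      right_triangle := adj.right_triangle },
    fun _ => rfl, fun _ => rfl⟩
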